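/- Let $J_n$ be the Bessel function of the first kind, $I_n$ the modified Bessel function of the first kind, and $\tilde I_n(x)=e^{-x}I_n(x)$. For integers $j,n\ge 0$ and real $t,r\ge 0$ put $$\mathcal J_{j,n}(t,r)=\int_0^1 \exp\Bigl(-\frac{(r-t+t\xi)^2}{2}\Bigr)\,\tilde I_j\bigl(rt(1-\xi)\bigr)\,\frac{(1-\xi)^n}{\sqrt{\xi}\,\sqrt{2-\xi}}\,d\xi ,$$ and let $$W(t,r)=-\int_0^\infty e^{-\omega^2/2}\sin(\omega t)J_0(r\omega)\,d\omega,$$ $$p'(t,r)=\int_0^\infty \omega e^{-\omega^2/2}J_0(r\omega)\cos(t\omega)\,d\omega,\qquad u_r'(t,r)=\int_0^\infty \omega e^{-\omega^2/2}J_1(r\omega)\sin(t\omega)\,d\omega .$$ All these integrals converge absolutely, and for all $t\ge 0$, $r\ge 0$ $$W(t,r)=-t\,\mathcal J_{0,1}(t,r),$$ $$p'(t,r)=\mathcal J_{0,1}(t,r)-t^2\mathcal J_{0,3}(t,r)+rt\,\mathcal J_{1,2}(t,r),\qquad u_r'(t,r)=-t^2\mathcal J_{1,2}(t,r)+rt\,\mathcal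 J_{0,1}(t,r).$$ Moreover, the right-hand sides of these formulas give a classical solution of the Cauchy problem for the wave potential of the two-dimensional Gaussian acoustic pulse: $W=-t\mathcal J_{0,1}$ is twice continuously differentiable on $\{t\ge 0,\ r\ge 0\}$ and satisfies $$\frac{\partial^2 W}{\partial t^2}-\frac1r\frac{\partial}{\partial r}\Bigl(r\frac{\partial W}{\partial r}\Bigr)=0\quad(t>0,\ r>0),\qquad W|_{t=0}=0,\qquad \frac{\partial W}{\partial t}\Big|_{t=0}=-\exp\Bigl(-\frac{r^2}{2}\Bigr),$$ and $p'=-\partial W/\partial t$, $u_r'=\partial W/\partial r$ for all $t\ge0$, $r\ge0$ (with one-sided derivatives at $t=0$ and at $r=0$). -/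

import Mathlib

open MeasureTheory Set Function

namespace AcousticPulse

/-- Bessel function of the first kind of integer index `n ≥ 0` (Bessel's integral),
`J_n(x) = π⁻¹ ∫₀^π cos (n φ - x sin φ) dφ`. -/
noncomputable def besselJ (n : ℕ) (x : ℝ) : ℝ :=
  (1 / Real.pi) * ∫ φ in (0 : ℝ)..Real.pi, Real.cos (n * φ - x * Real.sin φ)

/-- Modified Bessel function of the first kind of integer index `n ≥ 0`,
`I_n(x) = π⁻¹ ∫₀^π exp (x cos φ) cos (n φ) dφ`. -/
noncomputable def besselI (n : ℕ) (x : ℝ) : ℝ :=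
  (1 / Real.pi) * ∫ φ in (0 : ℝ)..Real.pi, Real.exp (x * Real.cos φ) * Real.cos (n * φ)

/-- The exponentially scaled modified Bessel function `exp (-x) I_n(x)`. -/
noncomputable def scaledBesselI (n : ℕ) (x : ℝ) : ℝ :=
  Real.exp (-x) * besselI n x

/-- The integrand of the integral `𝒥_{j,n}(t,r)`. -/
noncomputable def kernelJ (j n : ℕ) (t r ξ : ℝ) : ℝ :=
  Real.exp (-((r - t + t * ξ) ^ 2 / 2)) * scaledBesselI j (r * t * (1 - ξ)) *
    ((1 - ξ) ^ n / (Real.sqrt ξ * Real.sqrt (2 - ξ)))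

/-- The integral `𝒥_{j,n}(t,r)` over `(0,1)`. -/
noncomputable def integralJ (j n : ℕ) (t r : ℝ) : ℝ :=
  ∫ ξ in (0 : ℝ)..1, kernelJ j n t r ξ

/-- Integrand of the Fourier (Hankel) form of the wave potential. -/
noncomputable def potentialIntegrand (t r ω : ℝ) : ℝ :=
  Real.exp (-(ω ^ 2 / 2)) * Real.sin (ω * t) * besselJ 0 (r * ω)

/-- Integrand of the Fourier (Hankel) form of the pressure pulsation. -/
noncomputable def pressureIntegrand (t r ω : ℝ) : ℝ :=
  ω * Real.exp (-(ω ^ 2 / 2)) * (besselJ 0 (r * ω) * Real.cos (t * ω))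

/-- Integrand of the Fourier (Hankel) form of the radial velocity pulsation. -/
noncomputable def velocityIntegrand (t r ω : ℝ) : ℝ :=
  ω * Real.exp (-(ω ^ 2 / 2)) * (besselJ 1 (r * ω) * Real.sin (t * ω))

/-- The wave potential `W(t,r)` in Fourier form. -/
noncomputable def potential (t r : ℝ) : ℝ :=
  -∫ ω in Ioi (0 : ℝ), potentialIntegrand t r ω

/-- The pressure pulsation `p'(t,r)` in Fourier form. -/
noncomputable def pressure (t r : ℝ) : ℝ :=
  ∫ ω in Ioi (0 : ℝ), pressureIntegrand t r ω

/-- The radial velocity pulsation `u_r'(t,r)` in Fourier form. -/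
noncomputable def radialVelocity (t r : ℝ) : ℝ :=
  ∫ ω in Ioi (0 : ℝ), velocityIntegrand t r ω

/-- `W`, `p`, `u`, as functions of `t ≥ 0` and `r ≥ 0`, form a classical solution of the radial
Cauchy problem for the wave potential of the Gaussian pulse, together with the pressure and
radial velocity derived from the potential.  Derivatives at boundary points of the closed
quadrant are one-sided. -/
structure IsPulseSolution (W p u : ℝ → ℝ → ℝ) : Prop where
  /-- `W` is twice continuously differentiable up to the boundary `t = 0`, `r = 0`. -/
  regular : ContDiffOn ℝ 2 (uncurry W) (Ici 0 ×ˢ Ici 0)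
  /-- `∂²W/∂t² - r⁻¹ ∂/∂r (r ∂W/∂r) = 0` for `t > 0`, `r > 0`. -/
  wave : ∀ t r : ℝ, 0 < t → 0 < r →
    deriv (fun τ => deriv (fun σ => W σ r) τ) t
      - 1 / r * deriv (fun ρ => ρ * deriv (fun s => W t s) ρ) r = 0
  /-- `W = 0` at `t = 0`. -/
  initial : ∀ r : ℝ, 0 ≤ r → W 0 r = 0
  /-- `∂W/∂t = -exp (-r²/2)` at `t = 0`. -/
  initial_deriv : ∀ r : ℝ, 0 ≤ r →
    HasDerivWithinAt (fun τ => W τ r) (-Real.exp (-(r ^ 2 / 2))) (Ici 0) 0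
  /-- `p = -∂W/∂t`. -/
  pressure_eq : ∀ t r : ℝ, 0 ≤ t → 0 ≤ r →
    HasDerivWithinAt (fun τ => W τ r) (-p t r) (Ici 0) t
  /-- `u = ∂W/∂r`. -/
  velocity_eq : ∀ t r : ℝ, 0 ≤ t → 0 ≤ r →
    HasDerivWithinAt (fun ρ => W t ρ) (u t r) (Ici 0) r

end AcousticPulse

open AcousticPulse

/-! With `ξ = 1 - cos ψ`, `√ξ √(2-ξ)` becomes `sin ψ` and cancels the Jacobian. Thus `𝒥_{j,n}` is an
integral over `[0, π/2]` of a kernel smooth in all variables (`integralJ_eq_angular`). This gives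
convergence, regularity and differentiation under the integral.

The formula for `W` (`potential_eq`) rests on two classical integrals. Sonine's, `sin x = x ∫ cos ψ
J₀(x cos ψ) dψ` over `[0, π/2]` (`sin_eq_mul_integral_besselJ_zero`), replaces the sine at `x = ωt`.
After Fubini, the `ω`-integral is Weber's (`integral_mul_exp_mul_besselJ_zero_mul_besselJ_zero`)
with parameters `r` and `t cos ψ`, and its value is the angular kernel.

Differentiating `W` in both its Hankel and angular forms and comparing gives the pressure and
velocity. The wave equation is read off the Hankel form: `W_tt` and `r⁻¹(r W_r)_r` are the same
integral, since `(x J₁)' = x J₀`. -/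

open Filter Topology

/-! ### Parametric integrals over a compact interval. -/

/-- Differentiation under a compact interval integral with jointly continuous derivative. -/
theorem hasFDerivAt_intervalIntegral_of_continuous
    {E G : Type*} [NormedAddCommGroup E] [NormedSpace ℝ E] [ProperSpace E]
    [NormedAddCommGroup G] [NormedSpace ℝ G]
    {F : E → ℝ → G} {F' : E → ℝ → E →L[ℝ] G} {a b : ℝ}
    (hF : Continuous (uncurry F)) (hF' : Continuous (uncurry F'))
    (hd : ∀ x s, HasFDerivAt (fun y => F y s) (F' x s) x) (x : E) :
    HasFDerivAt (fun y => ∫ s in a..b, F y s) (∫ s in a..b, F' x s) x := by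
  obtain ⟨C, hC⟩ := ((isCompact_closedBall x 1).prod (isCompact_uIcc (a := a) (b := b))
    ).exists_bound_of_continuousOn hF'.continuousOn
  refine intervalIntegral.hasFDerivAt_integral_of_dominated_of_fderiv_le (bound := fun _ => C)
    (Metric.closedBall_mem_nhds x one_pos) ?_ ?_ ?_ ?_ (by simp) ?_
  · exact .of_forall fun y => (hF.comp (by fun_prop : Continuous fun s => (y, s))
      ).aestronglyMeasurable
  · exact (hF.comp (by fun_prop : Continuous fun s => (x, s))).intervalIntegrable _ _
  · exact (hF'.comp (by fun_prop : Continuous fun s => (x, s))).aestronglyMeasurable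
  · exact .of_forall fun s hs y hy => hC (y, s) ⟨hy, uIoc_subset_uIcc hs⟩
  · exact .of_forall fun s _ y _ => hd y s

theorem hasDerivAt_intervalIntegral_of_continuous
    {F F' : ℝ → ℝ → ℝ} {a b : ℝ}
    (hF : Continuous (uncurry F)) (hF' : Continuous (uncurry F'))
    (hd : ∀ x s, HasDerivAt (fun y => F y s) (F' x s) x) (x : ℝ) :
    HasDerivAt (fun y => ∫ s in a..b, F y s) (∫ s in a..b, F' x s) x := by
  obtain ⟨C, hC⟩ := ((isCompact_closedBall x 1).prod (isCompact_uIcc (a := a) (b := b))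
    ).exists_bound_of_continuousOn hF'.continuousOn
  refine (intervalIntegral.hasDerivAt_integral_of_dominated_loc_of_deriv_le (bound := fun _ => C)
    (Metric.closedBall_mem_nhds x one_pos) ?_ ?_ ?_ ?_ (by simp) ?_).2
  · exact .of_forall fun y => (hF.comp (by fun_prop : Continuous fun s => (y, s))
      ).aestronglyMeasurable
  · exact (hF.comp (by fun_prop : Continuous fun s => (x, s))).intervalIntegrable _ _
  · exact (hF'.comp (by fun_prop : Continuous fun s => (x, s))).aestronglyMeasurable
  · exact .of_forall fun s hs y hy => hC (y, s) ⟨hy, uIoc_subset_uIcc hs⟩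
  · exact .of_forall fun s _ y _ => hd y s

/-- Induction on the order: the derivative is again such an integral, of a partial derivative one
order less smooth. The codomain changes from `G` to `E →L[ℝ] G`, so `G` is quantified inside the
induction. -/
theorem contDiff_intervalIntegral {E : Type} [NormedAddCommGroup E] [NormedSpace ℝ E]
    [ProperSpace E] (n : ℕ) : ∀ {G : Type} [NormedAddCommGroup G] [NormedSpace ℝ G]
    {F : E → ℝ → G} (a b : ℝ), ContDiff ℝ n (uncurry F) →
    ContDiff ℝ n (fun y => ∫ s in a..b, F y s) := by
  induction n with
  | zero =>
    intro G _ _ F a b hF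
    exact contDiff_zero.2 (intervalIntegral.continuous_parametric_intervalIntegral_of_continuous'
      (contDiff_zero.1 hF) a b)
  | succ n ih =>
    intro G _ _ F a b hF
    push_cast at hF ⊢
    have hdF : ContDiff ℝ n (fderiv ℝ (uncurry F)) := hF.fderiv_right le_rfl
    have hF' : ContDiff ℝ n (uncurry fun (x : E) (s : ℝ) =>
        (fderiv ℝ (uncurry F) (x, s)).comp (ContinuousLinearMap.inl ℝ E ℝ)) :=
      hdF.clm_comp contDiff_const
    have hd : ∀ x s, HasFDerivAt (fun y => F y s)
        ((fderiv ℝ (uncurry F) (x, s)).comp (ContinuousLinearMap.inl ℝ E ℝ)) x := by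
      intro x s
      exact HasFDerivAt.comp (f := fun e : E => (e, s)) (g := uncurry F) x
        ((hF.differentiable (by simp)) (x, s)).hasFDerivAt (hasFDerivAt_prodMk_left x s)
    have key := hasFDerivAt_intervalIntegral_of_continuous (a := a) (b := b) hF.continuous
      hF'.continuous hd
    exact (contDiff_succ_iff_hasFDerivAt (n := n)).2 ⟨_, ih a b hF', key⟩

namespace AcousticPulse

/-! ### Smoothness, derivatives and bounds of Bessel functions. -/

theorem contDiff_besselI (n k : ℕ) : ContDiff ℝ k (besselI n) :=
  contDiff_const.mul (contDiff_intervalIntegral k 0 Real.pi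
    (F := fun x φ => Real.exp (x * Real.cos φ) * Real.cos (n * φ)) (by
      unfold uncurry; fun_prop))

theorem contDiff_besselJ (n k : ℕ) : ContDiff ℝ k (besselJ n) :=
  contDiff_const.mul (contDiff_intervalIntegral k 0 Real.pi
    (F := fun x φ => Real.cos (n * φ - x * Real.sin φ)) (by
      unfold uncurry; fun_prop))

@[fun_prop]
theorem continuous_besselJ (n : ℕ) : Continuous (besselJ n) := (contDiff_besselJ n 0).continuous

theorem hasDerivAt_besselI_zero (x : ℝ) : HasDerivAt (besselI 0) (besselI 1 x) x := by
  refine ((hasDerivAt_intervalIntegral_of_continuous (a := 0) (b := Real.pi)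
    (F := fun x φ => Real.exp (x * Real.cos φ) * Real.cos ((0 : ℕ) * φ))
    (F' := fun x φ => Real.exp (x * Real.cos φ) * Real.cos ((1 : ℕ) * φ))
    (by unfold uncurry; fun_prop) (by unfold uncurry; fun_prop) ?_ x).const_mul (1 / Real.pi))
  intro x s
  simpa using ((hasDerivAt_id x).mul_const (Real.cos s)).exp

theorem besselJ_zero_apply (x : ℝ) :
    besselJ 0 x = (1 / Real.pi) * ∫ φ in (0 : ℝ)..Real.pi, Real.cos (x * Real.sin φ) := by
  simp [besselJ]

theorem besselJ_one_apply (x : ℝ) :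
    besselJ 1 x =
      (1 / Real.pi) * ∫ φ in (0 : ℝ)..Real.pi, Real.sin φ * Real.sin (x * Real.sin φ) := by
  -- The integrand is odd under `φ ↦ π - φ`.
  have h0 : ∫ φ in (0 : ℝ)..Real.pi, Real.cos φ * Real.cos (x * Real.sin φ) = 0 := by
    have := intervalIntegral.integral_comp_sub_left
      (fun φ => Real.cos φ * Real.cos (x * Real.sin φ)) Real.pi (a := 0) (b := Real.pi)
    simp only [Real.cos_pi_sub, Real.sin_pi_sub, sub_self, sub_zero, neg_mul,
      intervalIntegral.integral_neg] at this
    linarith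
  unfold besselJ
  congr 1
  simp only [Nat.cast_one, one_mul, Real.cos_sub]
  rw [intervalIntegral.integral_add (by apply Continuous.intervalIntegrable; fun_prop)
    (by apply Continuous.intervalIntegrable; fun_prop), h0, zero_add]

theorem hasDerivAt_besselJ_zero (x : ℝ) : HasDerivAt (besselJ 0) (-besselJ 1 x) x := by
  have h := ((hasDerivAt_intervalIntegral_of_continuous (a := 0) (b := Real.pi)
    (F := fun x φ => Real.cos (x * Real.sin φ))
    (F' := fun x φ => -(Real.sin φ * Real.sin (x * Real.sin φ)))
    (by unfold uncurry; fun_prop) (by unfold uncurry; fun_prop) (fun x s => by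
      simpa [mul_comm] using ((hasDerivAt_id x).mul_const (Real.sin s)).cos)
    x).const_mul (1 / Real.pi))
  rw [intervalIntegral.integral_neg, mul_neg, ← besselJ_one_apply] at h
  exact h.congr_of_eventuallyEq (.of_forall besselJ_zero_apply)

/-- Integration by parts writes `J₁(x)` as `x` times a mean weighted by `cos²`. Differentiating `J₁`
gives the same mean weighted by `sin²`, and the weights add to one. -/
theorem hasDerivAt_mul_besselJ_one (x : ℝ) :
    HasDerivAt (fun y => y * besselJ 1 y) (x * besselJ 0 x) x := by
  have h := ((hasDerivAt_intervalIntegral_of_continuous (a := 0) (b := Real.pi)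
    (F := fun x φ => Real.sin φ * Real.sin (x * Real.sin φ))
    (F' := fun x φ => Real.sin φ ^ 2 * Real.cos (x * Real.sin φ))
    (by unfold uncurry; fun_prop) (by unfold uncurry; fun_prop) (fun x s => by
      refine ((((hasDerivAt_id x).mul_const (Real.sin s)).sin).const_mul
        (Real.sin s)).congr_deriv ?_
      simp only [id]; ring)
    x).const_mul (1 / Real.pi))
  have h1 := h.congr_of_eventuallyEq (.of_forall besselJ_one_apply)
  have h2 := (hasDerivAt_id x).mul h1
  have parts : ∫ φ in (0 : ℝ)..Real.pi, Real.sin φ * Real.sin (x * Real.sin φ)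
      = x * ∫ φ in (0 : ℝ)..Real.pi, Real.cos φ ^ 2 * Real.cos (x * Real.sin φ) := by
    have hd : ∀ φ ∈ uIcc 0 Real.pi, HasDerivAt (fun φ => -(Real.cos φ * Real.sin (x * Real.sin φ)))
        (Real.sin φ * Real.sin (x * Real.sin φ) -
          x * (Real.cos φ ^ 2 * Real.cos (x * Real.sin φ))) φ := by
      intro φ _
      refine ((Real.hasDerivAt_cos φ).mul
        (((Real.hasDerivAt_sin φ).const_mul x).sin)).neg.congr_deriv ?_
      ring
    have := intervalIntegral.integral_eq_sub_of_hasDerivAt hd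
      (by apply Continuous.intervalIntegrable; fun_prop)
    rw [intervalIntegral.integral_sub (by apply Continuous.intervalIntegrable; fun_prop)
      (by apply Continuous.intervalIntegrable; fun_prop),
      intervalIntegral.integral_const_mul] at this
    simp only [Real.sin_pi, Real.sin_zero, mul_zero, neg_zero, sub_zero] at this
    linarith
  refine h2.congr_deriv ?_
  rw [besselJ_one_apply, parts, besselJ_zero_apply]
  have : ∫ φ in (0 : ℝ)..Real.pi, Real.cos (x * Real.sin φ)
      = (∫ φ in (0 : ℝ)..Real.pi, Real.cos φ ^ 2 * Real.cos (x * Real.sin φ))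
        + ∫ φ in (0 : ℝ)..Real.pi, Real.sin φ ^ 2 * Real.cos (x * Real.sin φ) := by
    rw [← intervalIntegral.integral_add (by apply Continuous.intervalIntegrable; fun_prop)
      (by apply Continuous.intervalIntegrable; fun_prop)]
    simp only [← add_mul, Real.cos_sq_add_sin_sq, one_mul]
  rw [this]
  simp only [id]
  ring

theorem abs_besselJ_le_one (n : ℕ) (x : ℝ) : |besselJ n x| ≤ 1 := by
  unfold besselJ
  have h := intervalIntegral.norm_integral_le_of_norm_le_const (a := 0) (b := Real.pi) (C := 1)
    (f := fun φ => Real.cos (n * φ - x * Real.sin φ)) (fun φ _ => Real.abs_cos_le_one _)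
  rw [sub_zero, abs_of_pos Real.pi_pos, one_mul, Real.norm_eq_abs] at h
  rw [abs_mul, abs_of_pos (by positivity : 0 < 1 / Real.pi), one_div, inv_mul_le_iff₀ Real.pi_pos,
    mul_one]
  exact h

/-! ### The angular form of `𝒥_{j,n}` and its derivatives. -/

/-- The integrand of `integralJ` after the substitution `ξ = 1 - cos ψ`. -/
noncomputable def angularKernel (j n : ℕ) (t r ψ : ℝ) : ℝ :=
  Real.exp (-((r ^ 2 + (t * Real.cos ψ) ^ 2) / 2)) * besselI j (r * t * Real.cos ψ) *
    Real.cos ψ ^ n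

theorem contDiff_angularKernel (j n k : ℕ) :
    ContDiff ℝ k (fun p : (ℝ × ℝ) × ℝ => angularKernel j n p.1.1 p.1.2 p.2) := by
  unfold angularKernel
  have h := (contDiff_besselI j k).comp (f := fun p : (ℝ × ℝ) × ℝ => p.1.2 * p.1.1 * Real.cos p.2)
    (by fun_prop)
  unfold Function.comp at h
  fun_prop

theorem image_one_sub_cos :
    (fun ψ => 1 - Real.cos ψ) '' Ioo 0 (Real.pi / 2) = Ioo 0 1 := by
  have hpi := Real.pi_pos
  ext ξ
  constructor
  · rintro ⟨ψ, ⟨h0, h1⟩, rfl⟩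
    have := Real.cos_pos_of_mem_Ioo ⟨by linarith, h1⟩
    have h2 := Real.cos_lt_cos_of_nonneg_of_le_pi le_rfl (by linarith : ψ ≤ Real.pi) h0
    rw [Real.cos_zero] at h2
    exact ⟨by simpa using h2, by simpa using this⟩
  · rintro ⟨h0, h1⟩
    refine ⟨Real.arccos (1 - ξ), ⟨Real.arccos_pos.2 (by linarith),
      Real.arccos_lt_pi_div_two.2 (by linarith)⟩, ?_⟩
    simp only
    rw [Real.cos_arccos (by linarith) (by linarith)]
    ring

theorem injOn_one_sub_cos : InjOn (fun ψ => 1 - Real.cos ψ) (Ioo 0 (Real.pi / 2)) := by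
  have hpi := Real.pi_pos
  intro x hx y hy hxy
  exact Real.injOn_cos ⟨hx.1.le, by linarith [hx.2]⟩ ⟨hy.1.le, by linarith [hy.2]⟩
    (by simpa using hxy)

theorem abs_sin_smul_kernelJ (j n : ℕ) (t r : ℝ) {ψ : ℝ} (hψ : ψ ∈ Ioo 0 (Real.pi / 2)) :
    |Real.sin ψ| • kernelJ j n t r (1 - Real.cos ψ) = angularKernel j n t r ψ := by
  have hs : 0 < Real.sin ψ := Real.sin_pos_of_pos_of_lt_pi hψ.1 (by linarith [hψ.2, Real.pi_pos])
  have h1 : 0 ≤ 1 - Real.cos ψ := by linarith [Real.cos_le_one ψ]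
  have hsq : Real.sqrt (1 - Real.cos ψ) * Real.sqrt (2 - (1 - Real.cos ψ)) = Real.sin ψ := by
    rw [← Real.sqrt_mul h1, ← Real.sqrt_sq hs.le]
    congr 1
    nlinarith [Real.sin_sq_add_cos_sq ψ]
  -- The scaling `exp(-x)` of the Bessel function removes the cross term of the square.
  have he : Real.exp (-((r ^ 2 + (t * Real.cos ψ) ^ 2) / 2)) =
      Real.exp (-((r - t + t * (1 - Real.cos ψ)) ^ 2 / 2)) *
        Real.exp (-(r * t * Real.cos ψ)) := by
    rw [← Real.exp_add]
    congr 1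
    ring
  unfold kernelJ scaledBesselI angularKernel
  rw [hsq, sub_sub_cancel, he, abs_of_pos hs, smul_eq_mul]
  field_simp

theorem hasDerivWithinAt_one_sub_cos (ψ : ℝ) (s : Set ℝ) :
    HasDerivWithinAt (fun ψ => 1 - Real.cos ψ) (Real.sin ψ) s ψ := by
  simpa using ((Real.hasDerivAt_cos ψ).const_sub 1).hasDerivWithinAt

theorem continuous_angularKernel (j n : ℕ) (t r : ℝ) : Continuous (angularKernel j n t r) :=
  (contDiff_angularKernel j n 0).continuous.comp (by fun_prop : Continuous fun ψ => ((t, r), ψ))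

theorem intervalIntegrable_kernelJ (j n : ℕ) (t r : ℝ) :
    IntervalIntegrable (kernelJ j n t r) volume 0 1 := by
  rw [intervalIntegrable_iff_integrableOn_Ioo_of_le zero_le_one, ← image_one_sub_cos,
    integrableOn_image_iff_integrableOn_abs_deriv_smul measurableSet_Ioo
      (fun ψ _ => hasDerivWithinAt_one_sub_cos ψ _) injOn_one_sub_cos,
    integrableOn_congr_fun (fun ψ hψ => abs_sin_smul_kernelJ j n t r hψ) measurableSet_Ioo]
  exact (continuous_angularKernel j n t r).integrableOn_Icc.mono_set Ioo_subset_Icc_self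

theorem integralJ_eq_angular (j n : ℕ) (t r : ℝ) :
    integralJ j n t r = ∫ ψ in (0 : ℝ)..(Real.pi / 2), angularKernel j n t r ψ := by
  unfold integralJ
  rw [intervalIntegral.integral_of_le zero_le_one, integral_Ioc_eq_integral_Ioo,
    ← image_one_sub_cos, integral_image_eq_integral_abs_deriv_smul measurableSet_Ioo
      (fun ψ _ => hasDerivWithinAt_one_sub_cos ψ _) injOn_one_sub_cos,
    setIntegral_congr_fun measurableSet_Ioo (fun ψ hψ => abs_sin_smul_kernelJ j n t r hψ),
    intervalIntegral.integral_of_le (by positivity), integral_Ioc_eq_integral_Ioo]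

theorem contDiff_integralJ (j n k : ℕ) :
    ContDiff ℝ k (fun p : ℝ × ℝ => integralJ j n p.1 p.2) := by
  simp only [integralJ_eq_angular]
  exact contDiff_intervalIntegral k 0 (Real.pi / 2)
    (F := fun (p : ℝ × ℝ) ψ => angularKernel j n p.1 p.2 ψ) (contDiff_angularKernel j n k)

theorem continuous_angularKernel_time (j n : ℕ) (r : ℝ) :
    Continuous fun p : ℝ × ℝ => angularKernel j n p.1 r p.2 :=
  (contDiff_angularKernel j n 0).continuous.comp
    (by fun_prop : Continuous fun p : ℝ × ℝ => ((p.1, r), p.2))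

theorem continuous_angularKernel_radius (j n : ℕ) (t : ℝ) :
    Continuous fun p : ℝ × ℝ => angularKernel j n t p.1 p.2 :=
  (contDiff_angularKernel j n 0).continuous.comp
    (by fun_prop : Continuous fun p : ℝ × ℝ => ((t, p.1), p.2))

/-- The Gaussian contributes `-t cos² ψ`, raising `n` by two; the Bessel factor contributes `r cos
ψ` and `I₀' = I₁`. -/
theorem hasDerivAt_integralJ_time (n : ℕ) (t r : ℝ) :
    HasDerivAt (fun τ => integralJ 0 n τ r)
      (-t * integralJ 0 (n + 2) t r + r * integralJ 1 (n + 1) t r) t := by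
  simp only [integralJ_eq_angular]
  have hd : ∀ t ψ, HasDerivAt (fun τ => angularKernel 0 n τ r ψ)
      (-t * angularKernel 0 (n + 2) t r ψ + r * angularKernel 1 (n + 1) t r ψ) t := by
    intro t ψ
    have h1 : HasDerivAt (fun τ => -((r ^ 2 + (τ * Real.cos ψ) ^ 2) / 2))
        (-t * Real.cos ψ ^ 2) t := by
      refine (((((hasDerivAt_id t).mul_const (Real.cos ψ)).pow 2).const_add
        (r ^ 2)).div_const 2).neg.congr_deriv ?_
      simp only [id]; ring
    have h2 : HasDerivAt (fun τ => r * τ * Real.cos ψ) (r * Real.cos ψ) t := by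
      simpa using ((hasDerivAt_id t).const_mul r).mul_const (Real.cos ψ)
    refine ((h1.exp.mul ((hasDerivAt_besselI_zero (r * t * Real.cos ψ)).comp t h2)).mul_const
      (Real.cos ψ ^ n)).congr_deriv ?_
    simp only [angularKernel, Function.comp]
    ring
  have c0 := continuous_angularKernel_time 0 (n + 2) r
  have c1 := continuous_angularKernel_time 1 (n + 1) r
  refine (hasDerivAt_intervalIntegral_of_continuous (a := 0) (b := Real.pi / 2)
    (F := fun τ ψ => angularKernel 0 n τ r ψ) (continuous_angularKernel_time 0 n r)
    (by unfold uncurry; fun_prop) hd t).congr_deriv ?_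
  rw [intervalIntegral.integral_add
    (((continuous_angularKernel _ _ _ _).const_mul _).intervalIntegrable _ _)
    (((continuous_angularKernel _ _ _ _).const_mul _).intervalIntegrable _ _),
    intervalIntegral.integral_const_mul, intervalIntegral.integral_const_mul]

theorem hasDerivAt_integralJ_radius (n : ℕ) (t r : ℝ) :
    HasDerivAt (fun ρ => integralJ 0 n t ρ)
      (-r * integralJ 0 n t r + t * integralJ 1 (n + 1) t r) r := by
  simp only [integralJ_eq_angular]
  have hd : ∀ r ψ, HasDerivAt (fun ρ => angularKernel 0 n t ρ ψ)
      (-r * angularKernel 0 n t r ψ + t * angularKernel 1 (n + 1) t r ψ) r := by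
    intro r ψ
    have h1 : HasDerivAt (fun ρ => -((ρ ^ 2 + (t * Real.cos ψ) ^ 2) / 2)) (-r) r := by
      refine ((((hasDerivAt_id r).pow 2).add_const
        ((t * Real.cos ψ) ^ 2)).div_const 2).neg.congr_deriv ?_
      simp
    have h2 : HasDerivAt (fun ρ => ρ * t * Real.cos ψ) (t * Real.cos ψ) r := by
      simpa using ((hasDerivAt_id r).mul_const t).mul_const (Real.cos ψ)
    refine ((h1.exp.mul ((hasDerivAt_besselI_zero (r * t * Real.cos ψ)).comp r h2)).mul_const
      (Real.cos ψ ^ n)).congr_deriv ?_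
    simp only [angularKernel, Function.comp]
    ring
  have c0 := continuous_angularKernel_radius 0 n t
  have c1 := continuous_angularKernel_radius 1 (n + 1) t
  refine (hasDerivAt_intervalIntegral_of_continuous (a := 0) (b := Real.pi / 2)
    (F := fun ρ ψ => angularKernel 0 n t ρ ψ) (continuous_angularKernel_radius 0 n t)
    (by unfold uncurry; fun_prop) hd r).congr_deriv ?_
  rw [intervalIntegral.integral_add
    (((continuous_angularKernel _ _ _ _).const_mul _).intervalIntegrable _ _)
    (((continuous_angularKernel _ _ _ _).const_mul _).intervalIntegrable _ _),
    intervalIntegral.integral_const_mul, intervalIntegral.integral_const_mul]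

/-- The time derivative of the potential `-t 𝒥_{0,1}`. -/
theorem hasDerivAt_neg_mul_integralJ_time (t r : ℝ) :
    HasDerivAt (fun τ => -τ * integralJ 0 1 τ r)
      (-(integralJ 0 1 t r - t ^ 2 * integralJ 0 3 t r + r * t * integralJ 1 2 t r)) t := by
  refine ((hasDerivAt_id t).neg.mul (hasDerivAt_integralJ_time 1 t r)).congr_deriv ?_
  simp only [Pi.neg_apply, id]
  ring

/-- The radial derivative of the potential `-t 𝒥_{0,1}`. -/
theorem hasDerivAt_neg_mul_integralJ_radius (t r : ℝ) :
    HasDerivAt (fun ρ => -t * integralJ 0 1 t ρ)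
      (-t ^ 2 * integralJ 1 2 t r + r * t * integralJ 0 1 t r) r := by
  refine ((hasDerivAt_integralJ_radius 1 t r).const_mul (-t)).congr_deriv ?_
  ring

theorem integralJ_zero_one_initial (r : ℝ) : integralJ 0 1 0 r = Real.exp (-(r ^ 2 / 2)) := by
  have h0 : besselI 0 0 = 1 := by simp [besselI]
  rw [integralJ_eq_angular]
  simp [angularKernel, h0]

/-! ### The power series of `J₀` and Sonine's integral. -/

theorem hasSum_besselJ_zero (x : ℝ) :
    HasSum (fun m : ℕ => (-1) ^ m * x ^ (2 * m) / (2 * m).factorial *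
      ∏ i ∈ Finset.range m, (2 * (i : ℝ) + 1) / (2 * i + 2)) (besselJ 0 x) := by
  have h := intervalIntegral.hasSum_integral_of_dominated_convergence (μ := volume)
    (a := 0) (b := Real.pi)
    (F := fun (m : ℕ) φ => (-1) ^ m * (x * Real.sin φ) ^ (2 * m) / (2 * m).factorial)
    (f := fun φ => Real.cos (x * Real.sin φ))
    (fun (m : ℕ) _ => x ^ (2 * m) / (2 * m).factorial)
    (fun m => (by fun_prop : Continuous _).aestronglyMeasurable)
    (fun m => .of_forall fun φ _ => by
      rw [Real.norm_eq_abs, abs_div, abs_mul, abs_pow, abs_neg, abs_one, one_pow, one_mul,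
        Nat.abs_cast, mul_pow, abs_mul, pow_mul, abs_of_nonneg (by positivity : 0 ≤ (x ^ 2) ^ m),
        abs_pow]
      gcongr
      exact mul_le_of_le_one_right (by positivity)
        (pow_le_one₀ (abs_nonneg _) (Real.abs_sin_le_one _)))
    (.of_forall fun φ _ => (Real.hasSum_cosh x).summable)
    (by simp)
    (.of_forall fun φ _ => Real.hasSum_cos _)
  have h2 := h.mul_left (1 / Real.pi)
  rw [← besselJ_zero_apply] at h2
  refine (congrArg (HasSum · _) (funext fun m => ?_)).mpr h2
  have : ∀ φ, (-1) ^ m * (x * Real.sin φ) ^ (2 * m) / ((2 * m).factorial : ℝ) =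
      (-1) ^ m * x ^ (2 * m) / (2 * m).factorial * Real.sin φ ^ (2 * m) := by
    intro φ; ring
  simp only [this]
  rw [intervalIntegral.integral_const_mul, integral_sin_pow_even]
  field_simp

/-- The product of the even and odd Wallis factors telescopes; it turns `(2m)!` into `(2m+1)!` in
Sonine's integral. -/
theorem prod_wallis_mul (m : ℕ) :
    (∏ i ∈ Finset.range m, (2 * (i : ℝ) + 1) / (2 * i + 2)) *
      ∏ i ∈ Finset.range m, (2 * (i : ℝ) + 2) / (2 * i + 3) = 1 / (2 * m + 1) := by
  rw [← Finset.prod_mul_distrib]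
  induction m with
  | zero => simp
  | succ m ih =>
    rw [Finset.prod_range_succ, ih]
    push_cast
    field_simp
    ring

/-- Termwise integration of the series of `J₀`, dominated by the series of `cosh x`, yields the sine
series. -/
theorem sin_eq_mul_integral_besselJ_zero (x : ℝ) :
    Real.sin x =
      x * ∫ ψ in (0 : ℝ)..(Real.pi / 2), Real.cos ψ * besselJ 0 (x * Real.cos ψ) := by
  have hw (m : ℕ) : 0 ≤ ∏ i ∈ Finset.range m, (2 * (i : ℝ) + 1) / (2 * i + 2) :=
    Finset.prod_nonneg fun i _ => by positivity
  have hw1 (m : ℕ) : ∏ i ∈ Finset.range m, (2 * (i : ℝ) + 1) / (2 * i + 2) ≤ 1 :=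
    Finset.prod_le_one (fun i _ => by positivity) fun i _ => by
      rw [div_le_one (by positivity)]; linarith
  have h := intervalIntegral.hasSum_integral_of_dominated_convergence (μ := volume)
    (a := 0) (b := Real.pi / 2)
    (F := fun (m : ℕ) ψ => Real.cos ψ * ((-1) ^ m * (x * Real.cos ψ) ^ (2 * m) /
      (2 * m).factorial * ∏ i ∈ Finset.range m, (2 * (i : ℝ) + 1) / (2 * i + 2)))
    (f := fun ψ => Real.cos ψ * besselJ 0 (x * Real.cos ψ))
    (fun (m : ℕ) _ => x ^ (2 * m) / (2 * m).factorial)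
    (fun m => (by fun_prop : Continuous _).aestronglyMeasurable)
    (fun m => .of_forall fun φ _ => by
      rw [Real.norm_eq_abs, abs_mul, abs_mul, abs_of_nonneg (hw m),
        abs_div, abs_mul, abs_pow, abs_neg, abs_one, one_pow, one_mul,
        Nat.abs_cast, mul_pow, abs_mul, pow_mul, abs_of_nonneg (by positivity : 0 ≤ (x ^ 2) ^ m),
        abs_pow]
      have hx : 0 ≤ (x ^ 2) ^ m / (2 * m).factorial := by positivity
      have hc : |Real.cos φ| ^ (2 * m) ≤ 1 :=
        pow_le_one₀ (abs_nonneg _) (Real.abs_cos_le_one _)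
      calc |Real.cos φ| * ((x ^ 2) ^ m * |Real.cos φ| ^ (2 * m) / (2 * m).factorial * _)
          ≤ 1 * ((x ^ 2) ^ m * 1 / (2 * m).factorial * 1) := by
            gcongr
            exacts [Real.abs_cos_le_one _, hw1 m]
        _ = _ := by ring)
    (.of_forall fun φ _ => (Real.hasSum_cosh x).summable)
    (by simp)
    (.of_forall fun φ _ => (hasSum_besselJ_zero _).mul_left _)
  refine (Real.hasSum_sin x).unique ?_
  refine (congrArg (HasSum · _) (funext fun m => ?_)).mpr (h.mul_left x)
  have : ∀ ψ, Real.cos ψ * ((-1) ^ m * (x * Real.cos ψ) ^ (2 * m) /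
      ((2 * m).factorial : ℝ) * ∏ i ∈ Finset.range m, (2 * (i : ℝ) + 1) / (2 * i + 2)) =
      ((-1) ^ m * x ^ (2 * m) / (2 * m).factorial *
        ∏ i ∈ Finset.range m, (2 * (i : ℝ) + 1) / (2 * i + 2)) * Real.cos ψ ^ (2 * m + 1) := by
    intro ψ; ring
  simp only [this]
  rw [intervalIntegral.integral_const_mul, EulerSine.integral_cos_pow_eq, integral_sin_pow_odd,
    ← mul_assoc (1 / 2 : ℝ), one_div_mul_cancel two_ne_zero, one_mul, mul_assoc _ (Finset.prod _ _),
    prod_wallis_mul, Nat.factorial_succ]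
  push_cast
  field_simp
  ring

/-! ### Plane waves, Gaussians and Weber's integral. -/

/-- `J₀` as the mean of plane waves over directions. -/
theorem integral_cexp_cos_sub (x α : ℝ) :
    ∫ θ in (-Real.pi)..Real.pi, Complex.exp (Complex.I * ((x * Real.cos (θ - α) : ℝ) : ℂ)) =
      ((2 * Real.pi * besselJ 0 x : ℝ) : ℂ) := by
  set f : ℝ → ℂ := fun θ => Complex.exp (Complex.I * ((x * Real.sin θ : ℝ) : ℂ)) with hf
  have hfc : Continuous f := by fun_prop
  have hper : Function.Periodic f (2 * Real.pi) := fun θ => by simp only [hf, Real.sin_add_two_pi]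
  have h1 : ∀ θ, Complex.exp (Complex.I * ((x * Real.cos (θ - α) : ℝ) : ℂ)) =
      f (θ + (Real.pi / 2 - α)) := by
    intro θ
    simp only [hf]
    rw [← Real.sin_add_pi_div_two, show θ - α + Real.pi / 2 = θ + (Real.pi / 2 - α) by ring]
  simp only [h1]
  rw [intervalIntegral.integral_comp_add_right]
  have h2 := hper.intervalIntegral_add_eq (-Real.pi + (Real.pi / 2 - α)) (-Real.pi)
  rw [show -Real.pi + (Real.pi / 2 - α) + 2 * Real.pi = Real.pi + (Real.pi / 2 - α) by ring,
    show -Real.pi + 2 * Real.pi = Real.pi by ring] at h2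
  rw [h2, ← intervalIntegral.integral_add_adjacent_intervals (hfc.intervalIntegrable _ 0)
    (hfc.intervalIntegrable _ _)]
  have h3 := intervalIntegral.integral_comp_neg f (a := 0) (b := Real.pi)
  rw [neg_zero] at h3
  -- Folding `[-π, 0]` onto `[0, π]` pairs each exponential with its conjugate, leaving a real
  -- cosine.
  rw [← h3, ← intervalIntegral.integral_add
    ((by fun_prop : Continuous fun θ => f (-θ)).intervalIntegrable _ _)
    (hfc.intervalIntegrable _ _)]
  have h4 : ∀ θ, f (-θ) + f θ = ((2 * Real.cos (x * Real.sin θ) : ℝ) : ℂ) := by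
    intro θ
    simp only [hf, Real.sin_neg]
    push_cast
    rw [Complex.two_cos, add_comm]
    congr 2 <;> ring
  simp only [h4]
  rw [intervalIntegral.integral_ofReal, intervalIntegral.integral_const_mul, besselJ_zero_apply]
  congr 1
  field_simp

theorem integrable_pow_mul_exp_neg_sq_div_two (n : ℕ) :
    Integrable fun ω : ℝ => ω ^ n * Real.exp (-(ω ^ 2 / 2)) := by
  have h := integrable_rpow_mul_exp_neg_mul_sq (b := 1 / 2) (by norm_num) (s := n)
    (by linarith [(Nat.cast_nonneg n : (0 : ℝ) ≤ n)])
  refine h.congr (.of_forall fun ω => ?_)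
  simp only [Real.rpow_natCast]
  congr 2
  ring

theorem integrable_exp_neg_sq_div_two : Integrable fun ω : ℝ => Real.exp (-(ω ^ 2 / 2)) := by
  simpa using integrable_pow_mul_exp_neg_sq_div_two 0

theorem integral_cexp_mul_gaussian (p : ℝ) :
    ∫ x : ℝ, Complex.exp (Complex.I * ((p * x : ℝ) : ℂ)) * (Real.exp (-(x ^ 2 / 2)) : ℂ) =
      ((Real.sqrt (2 * Real.pi) * Real.exp (-(p ^ 2 / 2)) : ℝ) : ℂ) := by
  have h := fourierIntegral_gaussian (b := 1 / 2) (by norm_num) p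
  have h1 : ((Real.pi : ℂ) / (1 / 2)) ^ (1 / 2 : ℂ) = (Real.sqrt (2 * Real.pi) : ℂ) := by
    rw [Real.sqrt_eq_rpow, Complex.ofReal_cpow (by positivity)]
    push_cast
    congr 1
    ring
  rw [h1] at h
  push_cast
  convert h using 4 with x
  · congr 1; ring
  · ring_nf
  · ring

theorem integral_cexp_mul_gaussian_plane (p q : ℝ) :
    ∫ w : ℝ × ℝ, Complex.exp (Complex.I * ((p * w.1 + q * w.2 : ℝ) : ℂ)) *
        (Real.exp (-((w.1 ^ 2 + w.2 ^ 2) / 2)) : ℂ) =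
      ((2 * Real.pi * Real.exp (-((p ^ 2 + q ^ 2) / 2)) : ℝ) : ℂ) := by
  have h : ∀ w : ℝ × ℝ, Complex.exp (Complex.I * ((p * w.1 + q * w.2 : ℝ) : ℂ)) *
        (Real.exp (-((w.1 ^ 2 + w.2 ^ 2) / 2)) : ℂ) =
      (Complex.exp (Complex.I * ((p * w.1 : ℝ) : ℂ)) * (Real.exp (-(w.1 ^ 2 / 2)) : ℂ)) *
      (Complex.exp (Complex.I * ((q * w.2 : ℝ) : ℂ)) * (Real.exp (-(w.2 ^ 2 / 2)) : ℂ)) := by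
    intro w
    rw [mul_mul_mul_comm, ← Complex.exp_add, ← Complex.ofReal_mul, ← Real.exp_add]
    congr 2
    · push_cast; ring
    · congr 1; ring
  simp only [h]
  rw [Measure.volume_eq_prod, integral_prod_mul
    (fun x : ℝ => Complex.exp (Complex.I * ((p * x : ℝ) : ℂ)) * (Real.exp (-(x ^ 2 / 2)) : ℂ))
    (fun x : ℝ => Complex.exp (Complex.I * ((q * x : ℝ) : ℂ)) * (Real.exp (-(x ^ 2 / 2)) : ℂ)),
    integral_cexp_mul_gaussian, integral_cexp_mul_gaussian, ← Complex.ofReal_mul]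
  congr 1
  rw [mul_mul_mul_comm, Real.mul_self_sqrt (by positivity), ← Real.exp_add]
  congr 2
  ring

/-- The mean over directions of the Gaussian centred on a circle. -/
theorem integral_exp_gaussian_circle (a b : ℝ) :
    ∫ θ in (-Real.pi)..Real.pi,
        Real.exp (-(((b + a * Real.cos θ) ^ 2 + (a * Real.sin θ) ^ 2) / 2)) =
      2 * Real.pi * (Real.exp (-((a ^ 2 + b ^ 2) / 2)) * besselI 0 (a * b)) := by
  have h : ∀ θ, Real.exp (-(((b + a * Real.cos θ) ^ 2 + (a * Real.sin θ) ^ 2) / 2)) =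
      Real.exp (-((a ^ 2 + b ^ 2) / 2)) * Real.exp (-(a * b * Real.cos θ)) := by
    intro θ
    rw [← Real.exp_add]
    congr 1
    linear_combination (-(a ^ 2) / 2) * Real.sin_sq_add_cos_sq θ
  simp only [h]
  rw [intervalIntegral.integral_const_mul]
  set f : ℝ → ℝ := fun θ => Real.exp (-(a * b * Real.cos θ)) with hf
  have hfc : Continuous f := by fun_prop
  rw [← intervalIntegral.integral_add_adjacent_intervals (hfc.intervalIntegrable _ 0)
    (hfc.intervalIntegrable _ _)]
  have h3 := intervalIntegral.integral_comp_neg f (a := 0) (b := Real.pi)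
  -- The reflection `θ ↦ π - θ` corrects the sign of the exponent to that in `besselI`.
  have h4 := intervalIntegral.integral_comp_sub_left f Real.pi (a := 0) (b := Real.pi)
  simp only [hf, Real.cos_neg, neg_zero] at h3
  simp only [hf, Real.cos_pi_sub, sub_self, sub_zero, mul_neg, neg_neg] at h4
  rw [← h3, ← h4]
  simp only [besselI, Nat.cast_zero, zero_mul, Real.cos_zero, mul_one]
  field_simp
  ring

theorem norm_plane_wave_mul_gaussian (x y z : ℝ) :
    ‖Complex.exp (Complex.I * (x : ℂ)) * Complex.exp (Complex.I * (y : ℂ)) *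
      ((Real.exp z : ℝ) : ℂ)‖ = Real.exp z := by
  rw [norm_mul, norm_mul, mul_comm Complex.I, mul_comm Complex.I, Complex.norm_exp_ofReal_mul_I,
    Complex.norm_exp_ofReal_mul_I, Complex.norm_real, Real.norm_eq_abs, Real.abs_exp]
  ring

theorem integrable_gaussian_plane :
    Integrable fun w : ℝ × ℝ => Real.exp (-((w.1 ^ 2 + w.2 ^ 2) / 2)) := by
  refine (integrable_exp_neg_sq_div_two.mul_prod integrable_exp_neg_sq_div_two).congr
    (.of_forall fun w => ?_)
  simp only
  rw [← Real.exp_add]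
  congr 1
  ring

instance isFiniteMeasure_restrict_uIoc (a b : ℝ) :
    IsFiniteMeasure (volume.restrict (uIoc a b)) :=
  inferInstanceAs (IsFiniteMeasure (volume.restrict (Ioc (min a b) (max a b))))

/-- Weber's second exponential integral. -/
theorem integral_mul_exp_mul_besselJ_zero_mul_besselJ_zero (a b : ℝ) :
    ∫ ω in Ioi (0 : ℝ), ω * Real.exp (-(ω ^ 2 / 2)) * (besselJ 0 (a * ω) * besselJ 0 (b * ω)) =
      Real.exp (-((a ^ 2 + b ^ 2) / 2)) * besselI 0 (a * b) := by
  have hpi := Real.pi_pos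
  -- Two plane waves, of frequency `b` along the first axis and `a` in direction `θ`, under a
  -- Gaussian. Integrating over `w` first gives a Gaussian on a circle, hence `I₀(ab)`. Integrating
  -- over `θ` first gives `J₀(a|w|)`, and the polar angle of `w` then gives `J₀(b|w|)`.
  set f : ℝ → ℝ × ℝ → ℂ := fun θ w =>
    Complex.exp (Complex.I * ((b * w.1 : ℝ) : ℂ)) *
      Complex.exp (Complex.I * ((a * (Real.cos θ * w.1 + Real.sin θ * w.2) : ℝ) : ℂ)) *
      ((Real.exp (-((w.1 ^ 2 + w.2 ^ 2) / 2)) : ℝ) : ℂ) with hf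
  have hfc : Continuous (uncurry f) := by unfold uncurry; fun_prop
  have hint : Integrable (uncurry f)
      ((volume.restrict (uIoc (-Real.pi) Real.pi)).prod volume) := by
    refine Integrable.mono' (((integrable_const (1 : ℝ)).mul_prod integrable_gaussian_plane))
      hfc.aestronglyMeasurable (.of_forall fun z => ?_)
    rw [one_mul]
    exact (norm_plane_wave_mul_gaussian _ _ _).le
  have hswap := intervalIntegral_integral_swap hint
  have hleft : ∀ θ, ∫ w, f θ w =
      ((2 * Real.pi * Real.exp (-(((b + a * Real.cos θ) ^ 2 + (a * Real.sin θ) ^ 2) / 2)) : ℝ) :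
        ℂ) := by
    intro θ
    rw [← integral_cexp_mul_gaussian_plane]
    refine integral_congr_ae (.of_forall fun w => ?_)
    simp only [hf]
    rw [← Complex.exp_add]
    congr 2
    push_cast
    ring
  simp only [hleft] at hswap
  rw [intervalIntegral.integral_ofReal, intervalIntegral.integral_const_mul,
    integral_exp_gaussian_circle, ← integral_comp_polarCoord_symm] at hswap
  have hpolar : ∀ p : ℝ × ℝ, p.1 • ∫ θ in (-Real.pi)..Real.pi, f θ (polarCoord.symm p) =
      ((p.1 * Real.exp (-(p.1 ^ 2 / 2)) * (2 * Real.pi * besselJ 0 (a * p.1)) : ℝ) : ℂ) *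
        Complex.exp (Complex.I * ((b * p.1 * Real.cos (p.2 - 0) : ℝ) : ℂ)) := by
    rintro ⟨ω, α⟩
    have h1 : ∀ θ, f θ (polarCoord.symm (ω, α)) =
        (Complex.exp (Complex.I * ((b * ω * Real.cos (α - 0) : ℝ) : ℂ)) *
          ((Real.exp (-(ω ^ 2 / 2)) : ℝ) : ℂ)) *
        Complex.exp (Complex.I * ((a * ω * Real.cos (θ - α) : ℝ) : ℂ)) := by
      intro θ
      simp only [hf, polarCoord_symm_apply, sub_zero]
      rw [mul_right_comm, Real.cos_sub]
      congr 4
      · congr 1; ring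
      · congr 1
        linear_combination (ω ^ 2 / 2) * Real.sin_sq_add_cos_sq α
      · ring
    simp only [h1]
    rw [intervalIntegral.integral_const_mul, integral_cexp_cos_sub, Complex.real_smul]
    push_cast
    ring
  simp only [hpolar] at hswap
  have htarget : polarCoord.target = Ioi (0 : ℝ) ×ˢ Ioo (-Real.pi) Real.pi := rfl
  have hcont : Continuous fun p : ℝ × ℝ =>
      ((p.1 * Real.exp (-(p.1 ^ 2 / 2)) * (2 * Real.pi * besselJ 0 (a * p.1)) : ℝ) : ℂ) *
        Complex.exp (Complex.I * ((b * p.1 * Real.cos (p.2 - 0) : ℝ) : ℂ)) := by fun_prop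
  rw [htarget, Measure.volume_eq_prod, setIntegral_prod] at hswap
  · simp only [integral_const_mul] at hswap
    have hinner : ∀ x : ℝ, ∫ α in Ioo (-Real.pi) Real.pi,
        Complex.exp (Complex.I * ((x * Real.cos (α - 0) : ℝ) : ℂ)) =
        ((2 * Real.pi * besselJ 0 x : ℝ) : ℂ) := by
      intro x
      rw [← integral_cexp_cos_sub x 0, intervalIntegral.integral_of_le (by linarith),
        integral_Ioc_eq_integral_Ioo]
    simp only [hinner, ← Complex.ofReal_mul] at hswap
    rw [integral_complex_ofReal] at hswap
    have h2 := Complex.ofReal_injective hswap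
    have h3 : ∀ ω : ℝ, ω * Real.exp (-(ω ^ 2 / 2)) * (2 * Real.pi * besselJ 0 (a * ω)) *
        (2 * Real.pi * besselJ 0 (b * ω)) = (2 * Real.pi) * (2 * Real.pi) *
        (ω * Real.exp (-(ω ^ 2 / 2)) * (besselJ 0 (a * ω) * besselJ 0 (b * ω))) := by
      intro ω; ring
    simp only [h3] at h2
    rw [integral_const_mul, ← mul_assoc] at h2
    exact (mul_left_cancel₀ (by positivity) h2).symm
  · rw [IntegrableOn, ← Measure.prod_restrict]
    refine Integrable.mono' (((integrable_pow_mul_exp_neg_sq_div_two 1).restrict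
      (s := Ioi 0)).norm.mul_prod (integrable_const (2 * Real.pi)))
      hcont.aestronglyMeasurable (.of_forall fun p => ?_)
    rw [norm_mul, mul_comm Complex.I, Complex.norm_exp_ofReal_mul_I, mul_one, Complex.norm_real,
      norm_mul, norm_mul (2 * Real.pi), pow_one,
      Real.norm_of_nonneg (by positivity : 0 ≤ 2 * Real.pi)]
    exact mul_le_mul_of_nonneg_left
      (mul_le_of_le_one_right (by positivity) (abs_besselJ_le_one _ _)) (norm_nonneg _)

/-! ### Hankel integrals: the potential and its derivatives. -/

/-- Integrability of a continuous function dominated by a polynomial times the Gaussian. -/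
theorem integrableOn_of_le_pow_mul_gaussian {f : ℝ → ℝ} (hf : Continuous f) (n : ℕ)
    (h : ∀ ω, |f ω| ≤ |ω ^ n * Real.exp (-(ω ^ 2 / 2))|) : IntegrableOn f (Ioi 0) :=
  ((integrable_pow_mul_exp_neg_sq_div_two n).norm.mono' hf.aestronglyMeasurable
    (.of_forall h)).integrableOn

theorem potential_eq (t r : ℝ) : potential t r = -t * integralJ 0 1 t r := by
  -- The factor `ω` needed by Weber's integral is the prefactor `x = ωt` of Sonine's.
  set f : ℝ → ℝ → ℝ := fun ψ ω => t * Real.cos ψ * (ω * Real.exp (-(ω ^ 2 / 2)) *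
    (besselJ 0 (r * ω) * besselJ 0 (t * Real.cos ψ * ω))) with hf
  have hfc : Continuous (uncurry f) := by unfold uncurry; fun_prop
  have hint : Integrable (uncurry f)
      ((volume.restrict (uIoc 0 (Real.pi / 2))).prod (volume.restrict (Ioi 0))) := by
    refine Integrable.mono' (((integrable_const (|t|)).mul_prod
      ((integrable_pow_mul_exp_neg_sq_div_two 1).restrict (s := Ioi 0)).norm))
      hfc.aestronglyMeasurable (.of_forall fun z => ?_)
    simp only [uncurry, hf, pow_one, Real.norm_eq_abs]
    rw [abs_mul, abs_mul t, abs_mul (z.2 * _), abs_mul (besselJ _ _)]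
    have hc := Real.abs_cos_le_one z.1
    have h1 := abs_besselJ_le_one 0 (r * z.2)
    have h2 := abs_besselJ_le_one 0 (t * Real.cos z.1 * z.2)
    calc _ ≤ |t| * 1 * (|z.2 * Real.exp (-(z.2 ^ 2 / 2))| * (1 * 1)) := by gcongr
      _ = _ := by ring
  have hswap := intervalIntegral_integral_swap hint
  have hω : ∀ ω, ∫ ψ in (0 : ℝ)..(Real.pi / 2), f ψ ω = potentialIntegrand t r ω := by
    intro ω
    have h1 : ∀ ψ, f ψ ω = (t * ω * Real.exp (-(ω ^ 2 / 2)) * besselJ 0 (r * ω)) *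
        (Real.cos ψ * besselJ 0 (ω * t * Real.cos ψ)) := by
      intro ψ
      simp only [hf]
      rw [show t * Real.cos ψ * ω = ω * t * Real.cos ψ by ring]
      ring
    simp only [h1]
    rw [intervalIntegral.integral_const_mul, potentialIntegrand,
      sin_eq_mul_integral_besselJ_zero (ω * t)]
    ring
  have hψ : ∀ ψ, ∫ ω in Ioi (0 : ℝ), f ψ ω = t * angularKernel 0 1 t r ψ := by
    intro ψ
    simp only [hf]
    rw [integral_const_mul, integral_mul_exp_mul_besselJ_zero_mul_besselJ_zero, angularKernel,
      pow_one, mul_assoc r]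
    ring
  simp only [hω, hψ] at hswap
  rw [potential, ← hswap, intervalIntegral.integral_const_mul, integralJ_eq_angular, neg_mul]

/-- Differentiation under the Hankel integral, with a Gaussian majorant near the base point. -/
theorem hasDerivAt_integral_of_le_gaussian {F F' : ℝ → ℝ → ℝ} {x C : ℝ} (n : ℕ)
    (hF : ∀ y, Continuous (F y)) (hF' : Continuous (F' x)) (hint : IntegrableOn (F x) (Ioi 0))
    (hb : ∀ y ∈ Metric.ball x 1, ∀ ω, |F' y ω| ≤ C * |ω ^ n * Real.exp (-(ω ^ 2 / 2))|)
    (hd : ∀ y ω, HasDerivAt (fun z => F z ω) (F' y ω) y) :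
    HasDerivAt (fun y => ∫ ω in Ioi (0 : ℝ), F y ω) (∫ ω in Ioi (0 : ℝ), F' x ω) x :=
  (hasDerivAt_integral_of_dominated_loc_of_deriv_le (Metric.ball_mem_nhds x one_pos)
    (.of_forall fun y => (hF y).aestronglyMeasurable) hint hF'.aestronglyMeasurable
    (.of_forall fun ω y hy => hb y hy ω)
    ((integrable_pow_mul_exp_neg_sq_div_two n).norm.const_mul C).integrableOn
    (.of_forall fun ω y _ => hd y ω)).2

theorem abs_mul_mul_le_of_le_one {g x y : ℝ} (hx : |x| ≤ 1) (hy : |y| ≤ 1) :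
    |g * (x * y)| ≤ |g| := by
  rw [abs_mul, abs_mul]
  exact mul_le_of_le_one_right (abs_nonneg _) (mul_le_one₀ hx (abs_nonneg _) hy)

theorem integrableOn_potentialIntegrand (t r : ℝ) :
    IntegrableOn (potentialIntegrand t r) (Ioi 0) := by
  refine integrableOn_of_le_pow_mul_gaussian (by unfold potentialIntegrand; fun_prop) 0
    fun ω => ?_
  rw [potentialIntegrand, pow_zero, one_mul, mul_assoc]
  exact abs_mul_mul_le_of_le_one (Real.abs_sin_le_one _) (abs_besselJ_le_one _ _)

theorem integrableOn_pressureIntegrand (t r : ℝ) :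
    IntegrableOn (pressureIntegrand t r) (Ioi 0) := by
  refine integrableOn_of_le_pow_mul_gaussian (by unfold pressureIntegrand; fun_prop) 1
    fun ω => ?_
  rw [pressureIntegrand, pow_one]
  exact abs_mul_mul_le_of_le_one (abs_besselJ_le_one _ _) (Real.abs_cos_le_one _)

theorem integrableOn_velocityIntegrand (t r : ℝ) :
    IntegrableOn (velocityIntegrand t r) (Ioi 0) := by
  refine integrableOn_of_le_pow_mul_gaussian (by unfold velocityIntegrand; fun_prop) 1
    fun ω => ?_
  rw [velocityIntegrand, pow_one]
  exact abs_mul_mul_le_of_le_one (abs_besselJ_le_one _ _) (Real.abs_sin_le_one _)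

theorem hasDerivAt_potential_time (t r : ℝ) :
    HasDerivAt (fun τ => potential τ r) (-pressure t r) t := by
  refine (hasDerivAt_integral_of_le_gaussian (F := fun τ => potentialIntegrand τ r)
    (F' := fun τ => pressureIntegrand τ r) (C := 1) 1
    (fun y => by unfold potentialIntegrand; fun_prop) (by unfold pressureIntegrand; fun_prop)
    (integrableOn_potentialIntegrand t r) (fun y _ ω => ?_) fun y ω => ?_).neg
  · rw [pressureIntegrand, pow_one, one_mul]
    exact abs_mul_mul_le_of_le_one (abs_besselJ_le_one _ _) (Real.abs_cos_le_one _)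
  · refine (((((hasDerivAt_id y).const_mul ω).sin).const_mul _).mul_const _).congr_deriv ?_
    simp only [pressureIntegrand, id, mul_comm ω y]
    ring

theorem hasDerivAt_potential_radius (t r : ℝ) :
    HasDerivAt (fun ρ => potential t ρ) (radialVelocity t r) r := by
  have h := (hasDerivAt_integral_of_le_gaussian (x := r) (F := fun ρ => potentialIntegrand t ρ)
    (F' := fun ρ ω => -velocityIntegrand t ρ ω) (C := 1) 1
    (fun y => by unfold potentialIntegrand; fun_prop) (by unfold velocityIntegrand; fun_prop)
    (integrableOn_potentialIntegrand t r) (fun y _ ω => ?_) fun y ω => ?_).neg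
  · rwa [integral_neg, neg_neg] at h
  · rw [abs_neg, velocityIntegrand, pow_one, one_mul]
    exact abs_mul_mul_le_of_le_one (abs_besselJ_le_one _ _) (Real.abs_sin_le_one _)
  · refine (((hasDerivAt_besselJ_zero (y * ω)).comp y
      ((hasDerivAt_id y).mul_const ω)).const_mul _).congr_deriv ?_
    simp only [velocityIntegrand, mul_comm ω t]
    ring

theorem hasDerivAt_pressure_time (t r : ℝ) :
    HasDerivAt (fun τ => pressure τ r)
      (-∫ ω in Ioi (0 : ℝ),
        ω ^ 2 * Real.exp (-(ω ^ 2 / 2)) * (besselJ 0 (r * ω) * Real.sin (t * ω))) t := by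
  rw [← integral_neg]
  refine hasDerivAt_integral_of_le_gaussian (F := fun τ => pressureIntegrand τ r)
    (F' := fun τ ω => -(ω ^ 2 * Real.exp (-(ω ^ 2 / 2)) *
      (besselJ 0 (r * ω) * Real.sin (τ * ω)))) (C := 1) 2
    (fun y => by unfold pressureIntegrand; fun_prop) (by fun_prop)
    (integrableOn_pressureIntegrand t r) (fun y _ ω => ?_) fun y ω => ?_
  · rw [abs_neg, one_mul]
    exact abs_mul_mul_le_of_le_one (abs_besselJ_le_one _ _) (Real.abs_sin_le_one _)
  · refine (((((hasDerivAt_id y).mul_const ω).cos).const_mul _).const_mul _).congr_deriv ?_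
    simp only [id]
    ring

/-- Keeping the factor `ρ` puts `ρω J₁(ρω)` under the integral, whose derivative involves only `J₀`;
no division by `r` occurs. -/
theorem hasDerivAt_mul_radialVelocity (t r : ℝ) :
    HasDerivAt (fun ρ => ρ * radialVelocity t ρ)
      (r * ∫ ω in Ioi (0 : ℝ),
        ω ^ 2 * Real.exp (-(ω ^ 2 / 2)) * (besselJ 0 (r * ω) * Real.sin (t * ω))) r := by
  simp only [radialVelocity, ← integral_const_mul]
  refine hasDerivAt_integral_of_le_gaussian (F := fun ρ ω => ρ * velocityIntegrand t ρ ω)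
    (F' := fun ρ ω => ρ * (ω ^ 2 * Real.exp (-(ω ^ 2 / 2)) *
      (besselJ 0 (ρ * ω) * Real.sin (t * ω)))) (C := |r| + 1) 2
    -- The constant `|r| + 1` in the majorant bounds `|ρ|` on the unit ball about `r`.
    (fun y => by unfold velocityIntegrand; fun_prop) (by fun_prop)
    ((integrableOn_velocityIntegrand t r).const_mul r) (fun y hy ω => ?_) fun y ω => ?_
  · rw [abs_mul]
    have hy' : |y| ≤ |r| + 1 := by
      have := abs_sub_abs_le_abs_sub y r
      rw [Metric.mem_ball, Real.dist_eq] at hy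
      linarith
    exact mul_le_mul hy' (abs_mul_mul_le_of_le_one (abs_besselJ_le_one _ _)
      (Real.abs_sin_le_one _)) (abs_nonneg _) (by positivity)
  · have h := (((hasDerivAt_mul_besselJ_one (y * ω)).comp y
      ((hasDerivAt_id y).mul_const ω)).const_mul
      (Real.exp (-(ω ^ 2 / 2)) * Real.sin (t * ω)))
    refine (h.congr_of_eventuallyEq (.of_forall fun z => ?_)).congr_deriv ?_
    · simp only [velocityIntegrand, Function.comp, id]
      ring
    · ring

/-! ### Comparison of the two forms and the Cauchy problem. -/

theorem pressure_eq (t r : ℝ) : pressure t r =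
    integralJ 0 1 t r - t ^ 2 * integralJ 0 3 t r + r * t * integralJ 1 2 t r := by
  have h := hasDerivAt_potential_time t r
  simp only [potential_eq] at h
  exact neg_injective (h.unique (hasDerivAt_neg_mul_integralJ_time t r))

theorem radialVelocity_eq (t r : ℝ) : radialVelocity t r =
    -t ^ 2 * integralJ 1 2 t r + r * t * integralJ 0 1 t r := by
  have h := hasDerivAt_potential_radius t r
  simp only [potential_eq] at h
  exact h.unique (hasDerivAt_neg_mul_integralJ_radius t r)

theorem wave_equation_potential (t : ℝ) {r : ℝ} (hr : r ≠ 0) :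
    deriv (fun τ => deriv (fun σ => potential σ r) τ) t
      - 1 / r * deriv (fun ρ => ρ * deriv (fun s => potential t s) ρ) r = 0 := by
  simp only [fun τ => (hasDerivAt_potential_time τ r).deriv,
    fun ρ => (hasDerivAt_potential_radius t ρ).deriv]
  rw [HasDerivAt.deriv (f := fun τ => -pressure τ r) (hasDerivAt_pressure_time t r).neg,
    (hasDerivAt_mul_radialVelocity t r).deriv, neg_neg, ← mul_assoc,
    one_div_mul_cancel hr, one_mul, sub_self]

/-- The formulas are smooth on all of `ℝ²`, so the one-sided derivatives at the boundary are
restrictions of two-sided ones. -/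
theorem isPulseSolution_integralJ : IsPulseSolution
    (fun t r => -t * integralJ 0 1 t r)
    (fun t r => integralJ 0 1 t r - t ^ 2 * integralJ 0 3 t r + r * t * integralJ 1 2 t r)
    (fun t r => -t ^ 2 * integralJ 1 2 t r + r * t * integralJ 0 1 t r) where
  regular := (contDiff_fst.neg.mul (contDiff_integralJ 0 1 2)).contDiffOn
  wave t r _ hr := by
    simpa only [potential_eq] using wave_equation_potential t hr.ne'
  initial r _ := by simp
  initial_deriv r _ := by
    refine (hasDerivAt_neg_mul_integralJ_time 0 r).hasDerivWithinAt.congr_deriv ?_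
    rw [integralJ_zero_one_initial]
    ring
  pressure_eq t r _ _ := (hasDerivAt_neg_mul_integralJ_time t r).hasDerivWithinAt
  velocity_eq t r _ _ := (hasDerivAt_neg_mul_integralJ_radius t r).hasDerivWithinAt

end AcousticPulse

theorem lemma6 :
    -- the integrals below converge absolutely
    (∀ (j n : ℕ) (t r : ℝ), 0 ≤ t → 0 ≤ r →
      IntervalIntegrable (kernelJ j n t r) volume 0 1) ∧
    (∀ t r : ℝ, 0 ≤ t → 0 ≤ r →
      IntegrableOn (potentialIntegrand t r) (Ioi 0) ∧
      IntegrableOn (pressureIntegrand t r) (Ioi 0) ∧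
      IntegrableOn (velocityIntegrand t r) (Ioi 0)) ∧
    -- the third representation of the potential, the pressure and the radial velocity
    (∀ t r : ℝ, 0 ≤ t → 0 ≤ r →
      potential t r = -t * integralJ 0 1 t r ∧
      pressure t r =
        integralJ 0 1 t r - t ^ 2 * integralJ 0 3 t r + r * t * integralJ 1 2 t r ∧
      radialVelocity t r =
        -t ^ 2 * integralJ 1 2 t r + r * t * integralJ 0 1 t r) ∧
    -- these formulas give a solution of the Cauchy problem
    IsPulseSolution
      (fun t r => -t * integralJ 0 1 t r)
      (fun t r => integralJ 0 1 t r - t ^ 2 * integralJ 0 3 t r + r * t * integralJ 1 2 t r)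
      (fun t r => -t ^ 2 * integralJ 1 2 t r + r * t * integralJ 0 1 t r) := by
  exact ⟨fun j n t r _ _ => intervalIntegrable_kernelJ j n t r,
    fun t r _ _ => ⟨integrableOn_potentialIntegrand t r, integrableOn_pressureIntegrand t r,
      integrableOn_velocityIntegrand t r⟩,
    fun t r _ _ => ⟨potential_eq t r, pressure_eq t r, radialVelocity_eq t r⟩,
    isPulseSolution_integralJ⟩
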